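/- Let $N$ be a smooth manifold modelled on a Hausdorff locally convex space (finite dimensional, Banach, Fréchet, …) with a smooth action of $S^1$, and let $X$ be the vector field on $N$ generated by a fixed nonzero element of the Lie algebra of $S^1$. Let $\Lambda^n_{S^1}(N)$ be the space of smooth complex-valued $S^1$-invariant $n$-forms on $N$. (i) *Completed periodic equivariant cohomology* $h^m_{S^1}(N)$, $m\in\mathbb Z$, is the degree $m$ cohomology of $(\Lambda^*_{S^1}(N)[u,u^{-1}]],\ d-u\,i_X)$. Here $\deg u=2$, and the elements of degree $m$ are the series $\sum_{j} u^{j}\zeta_{j}$ with $\zeta_j\in\Lambda^{m-2j}_{S^1}(N)$, the sum running over all integers $j\le m/2$ (so possibly infinitely many negative, but only finitely many positive, powers of $u$). (ii) *Super equivariant cohomology* $\bar h^{\rm even}_{S^1}(N)$, $\bar h^{\rm odd}_{S^1}(N)$ is the cohomology of the $\mathbb Z/2$-graded complex with $\Lambda^{\rm even}_{S^1}(N)=\prod_{n\ge 0}\Lambda^{2n}_{S^1}(N)$, $\Lambda^{\rm odd}_{S^1}(N)=\prod_{n\ge 0}\Lambda^{2n+1}_{S^1}(N)$ and differential $d+i_X$.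 For an integer $m$ let $q_m$ be the map that sets $u=-1$: it sends an element $\sum_j u^j\zeta_j$ of degree $m$ to $\sum_j(-1)^j\zeta_j$, which lies in $\Lambda^{\rm even}_{S^1}(N)$ if $m$ is even and in $\Lambda^{\rm odd}_{S^1}(N)$ if $m$ is odd. For $k\in\mathbb Z$ define $$r_{2k}\Big(\sum_{n\ge0}\omega_{2n}\Big)=\sum_{n\ge 0}(-u)^{k-n}\omega_{2n},\qquad r_{2k+1}\Big(\sum_{n\ge0}\omega_{2n+1}\Big)=\sum_{n\ge 0}(-u)^{k-n}\omega_{2n+1}.$$ Then, for every $m$, the maps $q_m$ and $r_m$ are mutually inverse between the elements of degree $m$ of $\Lambda^*_{S^1}(N)[u,u^{-1}]]$ and the forms of the parity of $m$, and they intertwine the differentials: $$q_{m+1}\,(d-u\,i_X)=(d+i_X)\,q_m,\qquad (d-u\,i_X)\,r_m=r_{m+1}\,(d+i_X).$$ Consequently, for every $k\in\mathbb Z$, setting $u=-1$ induces isomorphisms of complex vector spaces $$q_{2k}:h^{2k}_{S^1}(N)\to\bar h^{\rm even}_{S^1}(N),\qquad q_{2k+1}:h^{2k+1}_{S^1}(N)\to\bar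 h^{\rm odd}_{S^1}(N),$$ whose inverses are induced by $r_{2k}$ and $r_{2k+1}$. -/

import Mathlib

open Filter
open scoped Topology

universe u v

set_option linter.unusedSectionVars false

noncomputable section

namespace CircleCohomology

/-! ### Smooth maps between open subsets of locally convex spaces (Bastiani calculus)

All derivatives below are derivatives at `0` of curves `ℝ → F` with values in a topological
vector space, so that finite dimensional, Banach and Fréchet manifolds (for instance the loop
space `C^∞(S¹, M)`) are all covered. -/

section Calculus

variable {F : Type v} [AddCommGroup F] [Module ℝ F] [TopologicalSpace F]

/-- The curve `γ` has derivative `L` at `0`. -/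
def HasVelocity (γ : ℝ → F) (L : F) : Prop :=
  Tendsto (fun t : ℝ => t⁻¹ • (γ t - γ 0)) (𝓝[≠] 0) (𝓝 L)

open Classical in
/-- The derivative at `0` of the curve `γ`, or `0` if there is none. -/
def velocity (γ : ℝ → F) : F :=
  if h : ∃ L, HasVelocity γ L then h.choose else 0

/-- `f : E → F` is of class `C^k` on the open set `U`. Class `C^0` means continuous on `U`;
class `C^{k+1}` means that `f` is continuous on `U`, that all directional derivatives
`df(x, v)` exist for `x ∈ U`, and that `df` is of class `C^k` on `U × E`. -/
def IsClassC : ℕ → ∀ {E : Type u} [AddCommGroup E] [Module ℝ E] [TopologicalSpace E],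
    (E → F) → Set E → Prop
  | 0, _, _, _, _, f, U => ContinuousOn f U
  | k + 1, E, _, _, _, f, U =>
      ContinuousOn f U ∧
      (∀ x ∈ U, ∀ v : E, ∃ L : F, HasVelocity (fun t : ℝ => f (x + t • v)) L) ∧
      IsClassC k (fun p : E × E => velocity fun t : ℝ => f (p.1 + t • p.2)) (U ×ˢ Set.univ)

/-- `f` is smooth on the open set `U`. -/
def IsSmoothOn {E : Type u} [AddCommGroup E] [Module ℝ E] [TopologicalSpace E]
    (f : E → F) (U : Set E) : Prop :=
  ∀ k : ℕ, IsClassC k f U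

theorem HasVelocity.velocity_eq [T2Space F] {γ : ℝ → F} {L : F} (h : HasVelocity γ L) :
    velocity γ = L := by
  have h' : ∃ L, HasVelocity γ L := ⟨L, h⟩
  rw [velocity, dif_pos h']
  exact tendsto_nhds_unique h'.choose_spec h

theorem HasVelocity.congr {γ δ : ℝ → F} {L : F} (h : HasVelocity γ L) (he : γ =ᶠ[𝓝 0] δ) :
    HasVelocity δ L := by
  refine Tendsto.congr' ?_ h
  filter_upwards [nhdsWithin_le_nhds he] with t ht
  rw [ht, he.eq_of_nhds]

theorem velocity_congr {γ δ : ℝ → F} (he : γ =ᶠ[𝓝 0] δ) : velocity γ = velocity δ := by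
  have : HasVelocity γ = HasVelocity δ := by
    funext L
    exact propext ⟨fun h => h.congr he, fun h => h.congr he.symm⟩
  unfold velocity
  rw [this]

theorem HasVelocity.add [ContinuousAdd F] {γ δ : ℝ → F} {L M : F} (h : HasVelocity γ L)
    (h' : HasVelocity δ M) : HasVelocity (fun t => γ t + δ t) (L + M) := by
  refine Tendsto.congr (fun t => ?_) (Tendsto.add h h')
  rw [← smul_add, add_sub_add_comm]

theorem hasVelocity_const (L : F) : HasVelocity (fun _ : ℝ => L) 0 := by
  simpa [HasVelocity] using tendsto_const_nhds

theorem HasVelocity.const_mul {γ : ℝ → ℂ} {L : ℂ} (a : ℂ) (h : HasVelocity γ L) :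
    HasVelocity (fun t => a * γ t) (a * L) := by
  refine Tendsto.congr (fun t => ?_) (Tendsto.const_mul a h)
  rw [← mul_sub, mul_smul_comm]

theorem velocity_const_mul (a : ℂ) (γ : ℝ → ℂ) :
    velocity (fun t => a * γ t) = a * velocity γ := by
  rcases eq_or_ne a 0 with rfl | ha
  · simpa using (hasVelocity_const (0 : ℂ)).velocity_eq
  by_cases h : ∃ L, HasVelocity γ L
  · obtain ⟨L, hL⟩ := h
    rw [hL.velocity_eq, (hL.const_mul a).velocity_eq]
  · have h' : ¬ ∃ L, HasVelocity (fun t => a * γ t) L := by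
      rintro ⟨L, hL⟩
      exact h ⟨a⁻¹ * L, by simpa [ha] using hL.const_mul a⁻¹⟩
    rw [velocity, velocity, dif_neg h, dif_neg h', mul_zero]

end Calculus

section SmoothLemmas

variable {E : Type u} [AddCommGroup E] [Module ℝ E] [TopologicalSpace E]

theorem eventually_line_mem [ContinuousAdd E] [ContinuousSMul ℝ E] {U : Set E} (hU : IsOpen U)
    {x : E} (hx : x ∈ U) (v : E) : ∀ᶠ t : ℝ in 𝓝 0, x + t • v ∈ U := by
  have hc : ContinuousAt (fun t : ℝ => x + t • v) 0 := by fun_prop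
  exact hc.eventually (hU.mem_nhds (by simpa using hx))

theorem IsClassC.congr (k : ℕ) :
    ∀ {E : Type u} [AddCommGroup E] [Module ℝ E] [TopologicalSpace E] [ContinuousAdd E]
      [ContinuousSMul ℝ E] {f g : E → ℂ} {U : Set E}, IsOpen U → Set.EqOn f g U →
      IsClassC k f U → IsClassC k g U := by
  induction k with
  | zero =>
    intro E _ _ _ _ _ f g U _ h hf
    exact ContinuousOn.congr hf h.symm
  | succ k ih =>
    intro E _ _ _ _ _ f g U hU h hf
    obtain ⟨h0, h1, h2⟩ := hf
    have hline : ∀ x ∈ U, ∀ v : E,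
        (fun t : ℝ => f (x + t • v)) =ᶠ[𝓝 0] (fun t : ℝ => g (x + t • v)) := fun x hx v => by
      filter_upwards [eventually_line_mem hU hx v] with t ht using h ht
    refine ⟨ContinuousOn.congr h0 h.symm, fun x hx v => ?_, ?_⟩
    · obtain ⟨L, hL⟩ := h1 x hx v
      exact ⟨L, hL.congr (hline x hx v)⟩
    · refine ih (hU.prod isOpen_univ) ?_ h2
      rintro ⟨x, v⟩ ⟨hx, -⟩
      exact velocity_congr (hline x hx v)

theorem IsClassC.zero (k : ℕ) :
    ∀ {E : Type u} [AddCommGroup E] [Module ℝ E] [TopologicalSpace E] {U : Set E},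
      IsClassC k (fun _ : E => (0 : ℂ)) U := by
  induction k with
  | zero => intro E _ _ _ U; exact continuousOn_const
  | succ k ih =>
    intro E _ _ _ U
    refine ⟨continuousOn_const, fun _ _ _ => ⟨0, hasVelocity_const 0⟩, ?_⟩
    simpa only [(hasVelocity_const (0 : ℂ)).velocity_eq] using ih

theorem IsClassC.add (k : ℕ) :
    ∀ {E : Type u} [AddCommGroup E] [Module ℝ E] [TopologicalSpace E] [ContinuousAdd E]
      [ContinuousSMul ℝ E] {f g : E → ℂ} {U : Set E}, IsOpen U →
      IsClassC k f U → IsClassC k g U → IsClassC k (fun x => f x + g x) U := by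
  induction k with
  | zero => intro E _ _ _ _ _ f g U _ hf hg; exact ContinuousOn.add hf hg
  | succ k ih =>
    intro E _ _ _ _ _ f g U hU hf hg
    refine ⟨hf.1.add hg.1, fun x hx v => ?_, ?_⟩
    · obtain ⟨L, hL⟩ := hf.2.1 x hx v
      obtain ⟨M, hM⟩ := hg.2.1 x hx v
      exact ⟨L + M, hL.add hM⟩
    refine IsClassC.congr k (hU.prod isOpen_univ) ?_
      (ih (hU.prod isOpen_univ) hf.2.2 hg.2.2)
    rintro ⟨x, v⟩ ⟨hx, -⟩
    obtain ⟨L, hL⟩ := hf.2.1 x hx v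
    obtain ⟨M, hM⟩ := hg.2.1 x hx v
    exact (congrArg₂ (· + ·) hL.velocity_eq hM.velocity_eq).trans (hL.add hM).velocity_eq.symm

theorem IsClassC.const_mul (a : ℂ) (k : ℕ) :
    ∀ {E : Type u} [AddCommGroup E] [Module ℝ E] [TopologicalSpace E] {f : E → ℂ} {U : Set E},
      IsClassC k f U → IsClassC k (fun x => a * f x) U := by
  induction k with
  | zero => intro E _ _ _ f U hf; exact continuousOn_const.mul hf
  | succ k ih =>
    intro E _ _ _ f U hf
    refine ⟨continuousOn_const.mul hf.1, fun x hx v => ?_, ?_⟩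
    · obtain ⟨L, hL⟩ := hf.2.1 x hx v
      exact ⟨a * L, hL.const_mul a⟩
    · simpa only [velocity_const_mul] using ih hf.2.2

end SmoothLemmas

/-! ### Smooth manifolds modelled on a locally convex space, and smooth circle actions -/

section Manifold

variable (E : Type u) [AddCommGroup E] [Module ℝ E] [TopologicalSpace E]
  [IsTopologicalAddGroup E] [ContinuousSMul ℝ E]
variable (N : Type v) [TopologicalSpace N] [ChartedSpace E N]

/-- The atlas of `N` is smooth: all transition maps are smooth. -/
def IsSmoothManifold : Prop :=
  ∀ e ∈ atlas E N, ∀ e' ∈ atlas E N, IsSmoothOn (fun y : E => e' (e.symm y)) (e.symm.trans e').source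

/-- The action of the circle on `N` is smooth: the action map `S¹ × N → N` is continuous and
`(t, x) ↦ exp(it) • x` is smooth in the charts of `N` (the map `t ↦ exp(it)` being a local
diffeomorphism `ℝ → S¹`). -/
def IsSmoothCircleAction [MulAction Circle N] : Prop :=
  Continuous (fun p : Circle × N => p.1 • p.2) ∧
  ∀ e ∈ atlas E N, ∀ e' ∈ atlas E N,
    IsSmoothOn (fun p : ℝ × E => e' (Circle.exp p.1 • e.symm p.2))
      {p : ℝ × E | p.2 ∈ e.target ∧ Circle.exp p.1 • e.symm p.2 ∈ e'.source}

/-! ### Differential forms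

The tangent space at `x : N` is identified with `E` through the chart `chartAt E x`. A *field* of
degree `n` assigns to each `x : N` a complex-valued function of `n` tangent vectors at `x`; it is
a differential form if these functions are alternating and multilinear and if it is smooth. -/

/-- Fields of complex-valued functions of `n` tangent vectors. -/
abbrev FormField (n : ℕ) : Type (max u v) := N → (Fin n → E) → ℂ

/-- Families of one field in each degree; `∏ₙ`. -/
abbrev FieldSeq : Type (max u v) := ∀ n : ℕ, FormField E N n

variable {E N}

/-- The expression of `ω` in the chart `e`, as a function of a point `y` of the target of `e` and
of `n` vectors of `E`. -/
def inChart {n : ℕ} (ω : FormField E N n) (e : OpenPartialHomeomorph N E) (p : E × (Fin n → E)) : ℂ :=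
  ω (e.symm p.1) fun i => velocity fun t : ℝ => chartAt E (e.symm p.1) (e.symm (p.1 + t • p.2 i))

/-- The derivative at `x` of a map `φ : N → N`, applied to a tangent vector at `x`. -/
def tangentMapAt (φ : N → N) (x : N) (w : E) : E :=
  velocity fun t : ℝ => chartAt E (φ x) (φ ((chartAt E x).symm (chartAt E x x + t • w)))

variable (E N) in
/-- `Λⁿ(N)`: smooth complex-valued differential `n`-forms on `N`. -/
def forms (n : ℕ) : Submodule ℂ (FormField E N n) where
  carrier := {ω | (∀ x, ∃ A : E [⋀^Fin n]→ₗ[ℝ] ℂ, ⇑A = ω x) ∧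
    ∀ e ∈ atlas E N, IsSmoothOn (inChart ω e) (e.target ×ˢ Set.univ)}
  zero_mem' := ⟨fun _ => ⟨0, rfl⟩, fun _ _ k => IsClassC.zero k⟩
  add_mem' := by
    rintro ω η ⟨h1, h2⟩ ⟨h1', h2'⟩
    refine ⟨fun x => ?_, fun e he k =>
      IsClassC.add k (e.open_target.prod isOpen_univ) (h2 e he k) (h2' e he k)⟩
    obtain ⟨A, hA⟩ := h1 x
    obtain ⟨B, hB⟩ := h1' x
    exact ⟨A + B, by ext w; simp [hA, hB]⟩
  smul_mem' := by
    rintro a ω ⟨h1, h2⟩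
    refine ⟨fun x => ?_, fun e he k => IsClassC.const_mul a k (h2 e he k)⟩
    obtain ⟨A, hA⟩ := h1 x
    exact ⟨a • A, by ext w; simp [hA]⟩

variable (E N) in
/-- `Λⁿ_{S¹}(N)`: the `n`-forms `ω` with `g^* ω = ω` for all `g` in the circle. -/
def invariantForms [MulAction Circle N] (n : ℕ) : Submodule ℂ (FormField E N n) where
  carrier := {ω | ω ∈ forms E N n ∧ ∀ (g : Circle) (x : N) (w : Fin n → E),
    ω (g • x) (fun i => tangentMapAt (fun y => g • y) x (w i)) = ω x w}
  zero_mem' := ⟨zero_mem _, fun _ _ _ => rfl⟩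
  add_mem' := by
    rintro ω η ⟨h1, h2⟩ ⟨h1', h2'⟩
    exact ⟨add_mem h1 h1', fun g x w => by simp [h2, h2']⟩
  smul_mem' := by
    rintro a ω ⟨h1, h2⟩
    exact ⟨Submodule.smul_mem _ a h1, fun g x w => by simp [h2]⟩

variable (E N) in
/-- `Λ^*_{S¹}(N) = ∏ₙ Λⁿ_{S¹}(N)`. -/
def invariantTotal [MulAction Circle N] : Submodule ℂ (FieldSeq E N) where
  carrier := {ω | ∀ n, ω n ∈ invariantForms E N n}
  zero_mem' := fun _ => zero_mem _
  add_mem' := fun h h' n => add_mem (h n) (h' n)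
  smul_mem' := fun a _ h n => Submodule.smul_mem _ a (h n)

/-- The exterior derivative of an `n`-form, computed at `x` in the chart `chartAt E x`:
`(dω)_x(w₀, …, wₙ) = ∑ᵢ (-1)ⁱ ∂_{wᵢ} ω(w₀, …, ŵᵢ, …, wₙ)` for constant `w₀, …, wₙ`. -/
def extD {n : ℕ} (ω : FormField E N n) : FormField E N (n + 1) := fun x w =>
  ∑ i : Fin (n + 1), (-1 : ℂ) ^ (i : ℕ) *
    velocity fun t : ℝ => inChart ω (chartAt E x) (chartAt E x x + t • w i, i.removeNth w)

/-- The exterior derivative on sequences of forms of all degrees. -/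
def dSeq (ω : FieldSeq E N) : FieldSeq E N
  | 0 => 0
  | n + 1 => extD (ω n)

variable (E) in
/-- The vector field `X` on `N` generated by the element `c` of the Lie algebra `ℝ` of the circle:
`X_x = d/dt exp(ict) • x` at `t = 0`. -/
def generatingField [MulAction Circle N] (c : ℝ) (x : N) : E :=
  velocity fun t : ℝ => chartAt E x (Circle.exp (c * t) • x)

/-- Interior product with `X` on sequences of forms of all degrees (zero on `0`-forms: the
component of degree `n` of `i_X ω` comes from the component of degree `n + 1` of `ω`). -/
def iX [MulAction Circle N] (c : ℝ) (ω : FieldSeq E N) : FieldSeq E N := fun n x w =>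
  ω (n + 1) x (Fin.cons (generatingField E c x) w)

/-! ### Super equivariant cohomology -/

section Super

variable [MulAction Circle N]

variable (E N) in
/-- `Λ^{even}_{S¹}(N)` for `p = 0` and `Λ^{odd}_{S¹}(N)` for `p = 1`. -/
def superForms (p : ZMod 2) : Submodule ℂ (FieldSeq E N) where
  carrier := {ω | ω ∈ invariantTotal E N ∧ ∀ n : ℕ, (n : ZMod 2) ≠ p → ω n = 0}
  zero_mem' := ⟨zero_mem _, fun _ _ => rfl⟩
  add_mem' := by
    rintro ω η ⟨h1, h2⟩ ⟨h1', h2'⟩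
    exact ⟨add_mem h1 h1', fun n hn => by simp [h2 n hn, h2' n hn]⟩
  smul_mem' := by
    rintro a ω ⟨h1, h2⟩
    exact ⟨Submodule.smul_mem _ a h1, fun n hn => by simp [h2 n hn]⟩

/-- `d + i_X`. -/
def superD (c : ℝ) (ω : FieldSeq E N) : FieldSeq E N := dSeq ω + iX c ω

end Super

/-! ### Completed periodic equivariant cohomology -/

section Periodic

variable [MulAction Circle N]

variable (E N) in
/-- `Λ^*_{S¹}(N)[u, u⁻¹]]`: series `∑ⱼ uʲ ζⱼ` with finitely many positive and possibly infinitely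
many negative powers of `u`, the coefficient `ζⱼ` being stored as `ζ j`. -/
def laurentForms : Submodule ℂ (ℤ → FieldSeq E N) where
  carrier := {ζ | (∀ j, ζ j ∈ invariantTotal E N) ∧ ∃ J : ℤ, ∀ j, J < j → ζ j = 0}
  zero_mem' := ⟨fun _ => zero_mem _, 0, fun _ _ => rfl⟩
  add_mem' := by
    rintro ζ ξ ⟨h1, J, hJ⟩ ⟨h1', J', hJ'⟩
    refine ⟨fun j => add_mem (h1 j) (h1' j), max J J', fun j hj => ?_⟩
    simp [hJ j (lt_of_le_of_lt (le_max_left _ _) hj), hJ' j (lt_of_le_of_lt (le_max_right _ _) hj)]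
  smul_mem' := by
    rintro a ζ ⟨h1, J, hJ⟩
    exact ⟨fun j => Submodule.smul_mem _ a (h1 j), J, fun j hj => by simp [hJ j hj]⟩

variable (E N) in
/-- The elements of `Λ^*_{S¹}(N)[u, u⁻¹]]` of degree `m`, where `u` has degree `2`: the coefficient
of `uʲ` is a form of degree `m - 2j`. -/
def periodicForms (m : ℤ) : Submodule ℂ (ℤ → FieldSeq E N) where
  carrier := {ζ | ζ ∈ laurentForms E N ∧
    ∀ (j : ℤ) (n : ℕ), (n : ℤ) + 2 * j ≠ m → ζ j n = 0}
  zero_mem' := ⟨zero_mem _, fun _ _ _ => rfl⟩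
  add_mem' := by
    rintro ζ ξ ⟨h1, h2⟩ ⟨h1', h2'⟩
    exact ⟨add_mem h1 h1', fun j n hn => by simp [h2 j n hn, h2' j n hn]⟩
  smul_mem' := by
    rintro a ζ ⟨h1, h2⟩
    exact ⟨Submodule.smul_mem _ a h1, fun j n hn => by simp [h2 j n hn]⟩

/-- `d - u i_X`. -/
def periodicD (c : ℝ) (ζ : ℤ → FieldSeq E N) : ℤ → FieldSeq E N := fun j =>
  dSeq (ζ j) - iX c (ζ (j - 1))

end Periodic

/-! ### Linearity of the differentials on smooth forms -/

section Linearity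

theorem hasVelocity_inChart {n : ℕ} {ω : FormField E N n} (hω : ω ∈ forms E N n) (x : N) (a : E)
    (b : Fin n → E) :
    ∃ L, HasVelocity (fun t : ℝ => inChart ω (chartAt E x) (chartAt E x x + t • a, b)) L := by
  have h := (hω.2 _ (chart_mem_atlas E x) 1).2.1 (chartAt E x x, b)
    ⟨mem_chart_target E x, trivial⟩ (a, 0)
  simpa using h

theorem extD_add {n : ℕ} {ω η : FormField E N n} (hω : ω ∈ forms E N n) (hη : η ∈ forms E N n) :
    extD (ω + η) = extD ω + extD η := by
  funext x w
  simp only [extD, Pi.add_apply, ← Finset.sum_add_distrib, ← mul_add]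
  refine Finset.sum_congr rfl fun i _ => ?_
  obtain ⟨L, hL⟩ := hasVelocity_inChart hω x (w i) (i.removeNth w)
  obtain ⟨M, hM⟩ := hasVelocity_inChart hη x (w i) (i.removeNth w)
  rw [hL.velocity_eq, hM.velocity_eq, ← (hL.add hM).velocity_eq]
  rfl

theorem extD_smul {n : ℕ} (a : ℂ) (ω : FormField E N n) : extD (a • ω) = a • extD ω := by
  funext x w
  simp only [extD, Pi.smul_apply, smul_eq_mul, Finset.mul_sum]
  refine Finset.sum_congr rfl fun i _ => ?_
  rw [mul_left_comm]
  exact congrArg _ (velocity_const_mul a _)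

theorem dSeq_smul (a : ℂ) (ω : FieldSeq E N) : dSeq (a • ω) = a • dSeq ω := by
  funext n
  cases n with
  | zero => simp [dSeq]
  | succ n => exact extD_smul a (ω n)

variable [MulAction Circle N]

theorem dSeq_add {ω η : FieldSeq E N} (hω : ω ∈ invariantTotal E N)
    (hη : η ∈ invariantTotal E N) : dSeq (ω + η) = dSeq ω + dSeq η := by
  funext n
  cases n with
  | zero => simp [dSeq]
  | succ n => exact extD_add (hω n).1 (hη n).1

/-- `d + i_X` on `Λ^{even}_{S¹}(N)` (`p = 0`) or `Λ^{odd}_{S¹}(N)` (`p = 1`). -/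
def superDiff (c : ℝ) (p : ZMod 2) : superForms E N p →ₗ[ℂ] FieldSeq E N where
  toFun ω := superD c ω
  map_add' ω η := by
    simp only [superD, Submodule.coe_add, dSeq_add ω.2.1 η.2.1]
    exact add_add_add_comm _ _ _ _
  map_smul' a ω := by
    simp only [superD, Submodule.coe_smul, dSeq_smul, RingHom.id_apply, smul_add]
    rfl

/-- `d - u i_X` on the elements of degree `m` of `Λ^*_{S¹}(N)[u, u⁻¹]]`. -/
def periodicDiff (c : ℝ) (m : ℤ) : periodicForms E N m →ₗ[ℂ] (ℤ → FieldSeq E N) where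
  toFun ζ := periodicD c ζ
  map_add' ζ ξ := by
    funext j
    simp only [periodicD, Submodule.coe_add, Pi.add_apply, dSeq_add (ζ.2.1.1 j) (ξ.2.1.1 j)]
    exact add_sub_add_comm _ _ _ _
  map_smul' a ζ := by
    funext j
    simp only [periodicD, Submodule.coe_smul, Pi.smul_apply, dSeq_smul, RingHom.id_apply, smul_sub]
    rfl

end Linearity

/-! ### The two cohomology theories

In each degree the cohomology is `Z / (B ∩ Z)`, where `Z` is the kernel of the differential and `B`
is the image of the differential of the preceding degree. Since the differentials square to zero
on invariant forms (Cartan's formula), `B ∩ Z = B`. -/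

section Cohomology

variable [MulAction Circle N]

variable (E N) in
/-- The elements of parity `p` with `(d + i_X) ω = 0`. -/
def superCocycles (c : ℝ) (p : ZMod 2) : Submodule ℂ (FieldSeq E N) :=
  (LinearMap.ker (superDiff c p)).map (superForms E N p).subtype

variable (E N) in
/-- The elements `(d + i_X) η`, where `η` has parity opposite to `p`. -/
def superCoboundaries (c : ℝ) (p : ZMod 2) : Submodule ℂ (FieldSeq E N) :=
  LinearMap.range (superDiff c (p + 1))

variable (E N) in
/-- `h̄^{even}_{S¹}(N)` for `p = 0` and `h̄^{odd}_{S¹}(N)` for `p = 1`: cocycles modulo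
coboundaries of the complex `(Λ^*_{S¹}(N), d + i_X)`. -/
abbrev SuperCohomology (c : ℝ) (p : ZMod 2) : Type (max u v) :=
  superCocycles E N c p ⧸ (superCoboundaries E N c p).submoduleOf (superCocycles E N c p)

variable (E N) in
/-- The elements of degree `m` with `(d - u i_X) ζ = 0`. -/
def periodicCocycles (c : ℝ) (m : ℤ) : Submodule ℂ (ℤ → FieldSeq E N) :=
  (LinearMap.ker (periodicDiff c m)).map (periodicForms E N m).subtype

variable (E N) in
/-- The elements `(d - u i_X) ξ`, where `ξ` has degree `m - 1`. -/
def periodicCoboundaries (c : ℝ) (m : ℤ) : Submodule ℂ (ℤ → FieldSeq E N) :=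
  LinearMap.range (periodicDiff c (m - 1))

variable (E N) in
/-- `h^m_{S¹}(N)`: cocycles modulo coboundaries in degree `m` of the complex
`(Λ^*_{S¹}(N)[u, u⁻¹]], d - u i_X)`. -/
abbrev PeriodicCohomology (c : ℝ) (m : ℤ) : Type (max u v) :=
  periodicCocycles E N c m ⧸ (periodicCoboundaries E N c m).submoduleOf (periodicCocycles E N c m)

/-- The class in `h̄^p_{S¹}(N)` of a form `ω` of parity `p` with `(d + i_X) ω = 0`. -/
def superClass {c : ℝ} {p : ZMod 2} (ω : FieldSeq E N) (h : ω ∈ superForms E N p)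
    (hD : superD c ω = 0) : SuperCohomology E N c p :=
  Submodule.Quotient.mk ⟨ω, ⟨ω, h⟩, hD, rfl⟩

/-- The class in `h^m_{S¹}(N)` of an element `ζ` of degree `m` with `(d - u i_X) ζ = 0`. -/
def periodicClass {c : ℝ} {m : ℤ} (ζ : ℤ → FieldSeq E N) (h : ζ ∈ periodicForms E N m)
    (hD : periodicD c ζ = 0) : PeriodicCohomology E N c m :=
  Submodule.Quotient.mk ⟨ζ, ⟨ζ, h⟩, hD, rfl⟩

end Cohomology

/-! ### The maps `q` and `r` -/

/-- Setting `u = -1`: `∑ⱼ uʲ ζⱼ ↦ ∑ⱼ (-1)ʲ ζⱼ`, degree by degree. If `ζ` is homogeneous, only one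
`ζⱼ` has a component of any given degree `n`. -/
def setU (ζ : ℤ → FieldSeq E N) : FieldSeq E N := fun n => ∑ᶠ j : ℤ, (-1 : ℂ) ^ j • ζ j n

/-- `ω ↦ ∑ (-u)ʲ ω_{m-2j}`, the sum over all `j` with `m - 2j ≥ 0`. For `m = 2k` this is
`∑ₙ (-u)^{k-n} ω_{2n}` and for `m = 2k+1` it is `∑ₙ (-u)^{k-n} ω_{2n+1}`. -/
def insertU (m : ℤ) (ω : FieldSeq E N) : ℤ → FieldSeq E N := fun j n =>
  if (n : ℤ) + 2 * j = m then (-1 : ℂ) ^ j • ω n else 0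

end Manifold

end CircleCohomology

end

/-! In a series of degree `m` the coefficient of `u^j` is a form of degree `n = m - 2j`, so `n` and
`m` determine `j`. The powers of `u` are then only bookkeeping, and setting `u = -1` loses nothing.
Infinitely many negative powers are allowed, which matches the product over all form degrees; the
bound on positive powers is automatic because `n ≥ 0`. Both `d` and `u i_X` raise the total degree
by one, and at `u = -1` the operator `d - u i_X` becomes `d + i_X`. The computation is done once,
for `r_m`, in `periodicD_insertU`. The statement for `q_m` (`setU_periodicD`) follows by conjugating
with the inverse bijections `insertU_setU` and `setU_insertU`. An isomorphism of complexes matches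
cocycles and coboundaries, hence induces one on the quotients. -/

namespace CircleCohomology

section SettingU

variable {E : Type u} [AddCommGroup E] [Module ℝ E] [TopologicalSpace E]
  [IsTopologicalAddGroup E] [ContinuousSMul ℝ E]
variable {N : Type v} [TopologicalSpace N] [ChartedSpace E N]

/-! ### Setting `u = -1` on homogeneous series -/

theorem natCast_eq_iff_exists_degree {m : ℤ} {p : ZMod 2} (hp : (m : ZMod 2) = p) (n : ℕ) :
    (n : ZMod 2) = p ↔ ∃ j : ℤ, (n : ℤ) + 2 * j = m := by
  rw [← hp, ← Int.cast_natCast n, ZMod.intCast_eq_intCast_iff_dvd_sub]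
  exact ⟨fun ⟨j, hj⟩ => ⟨j, by push_cast at hj; omega⟩, fun ⟨j, hj⟩ => ⟨j, by push_cast; omega⟩⟩

/-- The sign `(-1)^j` is its own inverse, which is why `setU` and `insertU` can carry the same sign.
-/
theorem neg_one_zpow_smul_smul {M : Type*} [AddCommGroup M] [Module ℂ M] (j : ℤ) (x : M) :
    (-1 : ℂ) ^ j • (-1 : ℂ) ^ j • x = x := by
  rw [smul_smul, ← mul_zpow]
  simp

/-- In a homogeneous series, only one power of `u` contributes to the component of degree `n`. -/
theorem setU_apply {m : ℤ} {ζ : ℤ → FieldSeq E N}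
    (hζ : ∀ (j : ℤ) (n : ℕ), (n : ℤ) + 2 * j ≠ m → ζ j n = 0) {j : ℤ} {n : ℕ}
    (h : (n : ℤ) + 2 * j = m) : setU ζ n = (-1 : ℂ) ^ j • ζ j n := by
  refine finsum_eq_single _ j fun i hi => ?_
  rw [hζ i n (by omega), smul_zero]

theorem setU_apply_eq_zero {m : ℤ} {ζ : ℤ → FieldSeq E N}
    (hζ : ∀ (j : ℤ) (n : ℕ), (n : ℤ) + 2 * j ≠ m → ζ j n = 0) {n : ℕ}
    (h : ∀ j : ℤ, (n : ℤ) + 2 * j ≠ m) : setU ζ n = 0 := by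
  simp [setU, hζ _ n (h _)]

theorem insertU_apply {m j : ℤ} {n : ℕ} (h : (n : ℤ) + 2 * j = m) (ω : FieldSeq E N) :
    insertU m ω j n = (-1 : ℂ) ^ j • ω n :=
  if_pos h

theorem insertU_apply_of_ne {m j : ℤ} {n : ℕ} (h : (n : ℤ) + 2 * j ≠ m) (ω : FieldSeq E N) :
    insertU m ω j n = 0 :=
  if_neg h

theorem insertU_add (m : ℤ) (ω η : FieldSeq E N) :
    insertU m (ω + η) = insertU m ω + insertU m η := by
  funext j n
  by_cases h : (n : ℤ) + 2 * j = m <;> simp [insertU, h]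

theorem insertU_smul (m : ℤ) (a : ℂ) (ω : FieldSeq E N) :
    insertU m (a • ω) = a • insertU m ω := by
  funext j n
  by_cases h : (n : ℤ) + 2 * j = m
  · simpa only [Pi.smul_apply, insertU_apply h] using smul_comm _ _ _
  · simp [insertU, h]

theorem insertU_zero (m : ℤ) : insertU m (0 : FieldSeq E N) = 0 := by
  simpa using insertU_smul m 0 (0 : FieldSeq E N)

theorem insertU_setU {m : ℤ} {ζ : ℤ → FieldSeq E N}
    (hζ : ∀ (j : ℤ) (n : ℕ), (n : ℤ) + 2 * j ≠ m → ζ j n = 0) : insertU m (setU ζ) = ζ := by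
  funext j n
  by_cases h : (n : ℤ) + 2 * j = m
  · rw [insertU_apply h, setU_apply hζ h, neg_one_zpow_smul_smul]
  · rw [insertU_apply_of_ne h, hζ j n h]

theorem setU_insertU {m : ℤ} {p : ZMod 2} (hp : (m : ZMod 2) = p) {ω : FieldSeq E N}
    (hω : ∀ n : ℕ, (n : ZMod 2) ≠ p → ω n = 0) : setU (insertU m ω) = ω := by
  have hr : ∀ (j : ℤ) (n : ℕ), (n : ℤ) + 2 * j ≠ m → insertU m ω j n = 0 :=
    fun _ _ h => insertU_apply_of_ne h ω
  funext n
  by_cases hn : (n : ZMod 2) = p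
  · obtain ⟨j, hj⟩ := (natCast_eq_iff_exists_degree hp n).1 hn
    rw [setU_apply hr hj, insertU_apply hj, neg_one_zpow_smul_smul]
  · rw [hω n hn, setU_apply_eq_zero hr]
    exact fun j hj => hn ((natCast_eq_iff_exists_degree hp n).2 ⟨j, hj⟩)

theorem extD_zero {n : ℕ} : extD (0 : FormField E N n) = 0 := by
  simpa using extD_smul 0 (0 : FormField E N n)

/-! ### Invariant forms and compatibility with the differentials -/

variable [MulAction Circle N]

theorem setU_mem_superForms {m : ℤ} {p : ZMod 2} (hp : (m : ZMod 2) = p)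
    {ζ : ℤ → FieldSeq E N} (hζ : ζ ∈ periodicForms E N m) : setU ζ ∈ superForms E N p := by
  have hzero : ∀ n : ℕ, (n : ZMod 2) ≠ p → setU ζ n = 0 := fun n hn =>
    setU_apply_eq_zero hζ.2 fun j hj => hn ((natCast_eq_iff_exists_degree hp n).2 ⟨j, hj⟩)
  refine ⟨fun n => ?_, hzero⟩
  by_cases hn : (n : ZMod 2) = p
  · obtain ⟨j, hj⟩ := (natCast_eq_iff_exists_degree hp n).1 hn
    rw [setU_apply hζ.2 hj]
    exact Submodule.smul_mem _ _ (hζ.1.1 j n)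
  · rw [hzero n hn]
    exact zero_mem _

theorem insertU_mem_periodicForms (m : ℤ) {ω : FieldSeq E N} (hω : ω ∈ invariantTotal E N) :
    insertU m ω ∈ periodicForms E N m := by
  -- Since `n ≥ 0`, the equation `n + 2j = m` forces `j ≤ m / 2` (floor division, also for negative
  -- `m`).
  refine ⟨⟨fun j n => ?_, m / 2, fun j hj => ?_⟩, fun _ _ h => insertU_apply_of_ne h ω⟩
  · by_cases h : (n : ℤ) + 2 * j = m
    · rw [insertU_apply h]
      exact Submodule.smul_mem _ _ (hω n)
    · rw [insertU_apply_of_ne h]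
      exact zero_mem _
  · funext n
    exact insertU_apply_of_ne (by omega) ω

/-- A comparison of coefficients using only that `d` and `i_X` commute with scalars, so no parity or
smoothness of `ω` enters. -/
theorem periodicD_insertU (c : ℝ) (m : ℤ) (ω : FieldSeq E N) :
    periodicD c (insertU m ω) = insertU (m + 1) (superD c ω) := by
  have hd : ∀ (j : ℤ) (n : ℕ),
      dSeq (insertU m ω j) n = if (n : ℤ) + 2 * j = m + 1 then (-1 : ℂ) ^ j • dSeq ω n else 0 := by
    intro j n
    cases n with
    | zero => simp [dSeq]
    | succ n =>
      by_cases h : (n : ℤ) + 2 * j = m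
      · rw [if_pos (by push_cast; omega)]
        simp only [dSeq, insertU_apply h, extD_smul]
      · rw [if_neg (by push_cast; omega)]
        simp only [dSeq, insertU_apply_of_ne h, extD_zero]
  -- The factor `u` shifts `j` and `i_X` lowers the form degree: `(n + 1) + 2(j - 1) = m` is the
  -- same as `n + 2j = m + 1`. The sign `(-1)^(j-1) = -(-1)^j` turns `-u i_X` into `+i_X`.
  have hi : ∀ (j : ℤ) (n : ℕ), iX c (insertU m ω (j - 1)) n =
      if (n : ℤ) + 2 * j = m + 1 then -((-1 : ℂ) ^ j • iX c ω n) else 0 := by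
    intro j n
    funext x w
    by_cases h : (n : ℤ) + 2 * j = m + 1
    · have hs : (-1 : ℂ) ^ (j - 1) = -(-1 : ℂ) ^ j := by
        rw [zpow_sub_one₀ (by norm_num)]
        norm_num
      rw [if_pos h]
      simp only [iX]
      rw [insertU_apply (by push_cast; omega), hs]
      simp [iX]
    · rw [if_neg h]
      simp only [iX]
      rw [insertU_apply_of_ne (by push_cast; omega)]
      rfl
  funext j n
  change dSeq (insertU m ω j) n - iX c (insertU m ω (j - 1)) n = _
  rw [hd, hi]
  by_cases h : (n : ℤ) + 2 * j = m + 1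
  · rw [if_pos h, if_pos h, insertU_apply h, sub_neg_eq_add, ← smul_add]
    rfl
  · rw [if_neg h, if_neg h, insertU_apply_of_ne h, sub_zero]

/-- Both `d` and `i_X` change the form degree by one, in opposite directions, and these shifts agree
modulo 2. -/
theorem superD_apply_eq_zero (c : ℝ) {p : ZMod 2} {ω : FieldSeq E N}
    (hω : ∀ n : ℕ, (n : ZMod 2) ≠ p → ω n = 0) (n : ℕ) (hn : (n : ZMod 2) ≠ p + 1) :
    superD c ω n = 0 := by
  have hi : iX c ω n = 0 := by
    funext x w
    simp only [iX]
    rw [hω (n + 1)]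
    · rfl
    · intro h
      apply hn
      rw [← h]
      push_cast
      rw [add_assoc, CharTwo.add_self_eq_zero, add_zero]
  have hd : dSeq ω n = 0 := by
    cases n with
    | zero => rfl
    | succ n =>
      simp only [dSeq]
      rw [hω n fun h => hn (by rw [← h]; push_cast; rfl), extD_zero]
  change dSeq ω n + iX c ω n = 0
  rw [hd, hi, add_zero]

theorem setU_periodicD (c : ℝ) {m : ℤ} {ζ : ℤ → FieldSeq E N} (hζ : ζ ∈ periodicForms E N m) :
    setU (periodicD c ζ) = superD c (setU ζ) := by
  -- Writing `ζ` as `r_m (q_m ζ)` reduces the claim to `periodicD_insertU`; then `q_{m+1}` cancels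
  -- `r_{m+1}` on forms of the opposite parity.
  conv_lhs => rw [← insertU_setU hζ.2, periodicD_insertU]
  exact setU_insertU (p := (m : ZMod 2) + 1) (by push_cast; rfl)
    (superD_apply_eq_zero c (setU_mem_superForms rfl hζ).2)

/-! ### Passage to cohomology -/

theorem mem_superCocycles {c : ℝ} {p : ZMod 2} {ω : FieldSeq E N} :
    ω ∈ superCocycles E N c p ↔ ω ∈ superForms E N p ∧ superD c ω = 0 :=
  ⟨by rintro ⟨ω, h, rfl⟩; exact ⟨ω.2, h⟩, fun h => ⟨⟨ω, h.1⟩, h.2, rfl⟩⟩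

theorem mem_periodicCocycles {c : ℝ} {m : ℤ} {ζ : ℤ → FieldSeq E N} :
    ζ ∈ periodicCocycles E N c m ↔ ζ ∈ periodicForms E N m ∧ periodicD c ζ = 0 :=
  ⟨by rintro ⟨ζ, h, rfl⟩; exact ⟨ζ.2, h⟩, fun h => ⟨⟨ζ, h.1⟩, h.2, rfl⟩⟩

theorem mem_superCoboundaries {c : ℝ} {p : ZMod 2} {ω : FieldSeq E N} :
    ω ∈ superCoboundaries E N c p ↔ ∃ η ∈ superForms E N (p + 1), superD c η = ω :=
  ⟨fun ⟨η, h⟩ => ⟨η, η.2, h⟩, fun ⟨η, hη, h⟩ => ⟨⟨η, hη⟩, h⟩⟩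

theorem mem_periodicCoboundaries {c : ℝ} {m : ℤ} {ζ : ℤ → FieldSeq E N} :
    ζ ∈ periodicCoboundaries E N c m ↔ ∃ ξ ∈ periodicForms E N (m - 1), periodicD c ξ = ζ :=
  ⟨fun ⟨ξ, h⟩ => ⟨ξ, ξ.2, h⟩, fun ⟨ξ, hξ, h⟩ => ⟨⟨ξ, hξ⟩, h⟩⟩

theorem insertU_mem_periodicCocycles {c : ℝ} (m : ℤ) {p : ZMod 2} {ω : FieldSeq E N}
    (hω : ω ∈ superCocycles E N c p) : insertU m ω ∈ periodicCocycles E N c m := by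
  obtain ⟨h, hD⟩ := mem_superCocycles.1 hω
  refine mem_periodicCocycles.2 ⟨insertU_mem_periodicForms m h.1, ?_⟩
  rw [periodicD_insertU, hD, insertU_zero]

theorem superD_setU_eq_zero {c : ℝ} {m : ℤ} {ζ : ℤ → FieldSeq E N}
    (hζ : ζ ∈ periodicForms E N m) (hD : periodicD c ζ = 0) : superD c (setU ζ) = 0 := by
  rw [← setU_periodicD c hζ, hD]
  funext n
  simp [setU]

/-- The bijection `r_m` from the cocycles of parity `m` onto the cocycles of degree `m`. -/
noncomputable def cocyclesEquiv (c : ℝ) {m : ℤ} {p : ZMod 2} (hp : (m : ZMod 2) = p) :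
    superCocycles E N c p ≃ₗ[ℂ] periodicCocycles E N c m where
  toFun ω := ⟨insertU m ω, insertU_mem_periodicCocycles m ω.2⟩
  map_add' ω η := Subtype.ext (insertU_add m _ _)
  map_smul' a ω := Subtype.ext (insertU_smul m a _)
  invFun ζ := ⟨setU ζ, by
    obtain ⟨h, hD⟩ := mem_periodicCocycles.1 ζ.2
    exact mem_superCocycles.2 ⟨setU_mem_superForms hp h, superD_setU_eq_zero h hD⟩⟩
  left_inv ω := Subtype.ext (setU_insertU hp (mem_superCocycles.1 ω.2).1.2)
  right_inv ζ := Subtype.ext (insertU_setU (mem_periodicCocycles.1 ζ.2).1.2)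

theorem coe_cocyclesEquiv_symm (c : ℝ) {m : ℤ} {p : ZMod 2} (hp : (m : ZMod 2) = p)
    (ζ : periodicCocycles E N c m) :
    ((cocyclesEquiv c hp).symm ζ : FieldSeq E N) = setU (ζ : ℤ → FieldSeq E N) :=
  rfl

/-- Primitives need not be cocycles, so they are carried across by `insertU (m - 1)` and `setU` on
whole spaces of forms, and the intertwining relations do the rest. -/
theorem map_cocyclesEquiv_coboundaries (c : ℝ) {m : ℤ} {p : ZMod 2} (hp : (m : ZMod 2) = p) :
    ((superCoboundaries E N c p).submoduleOf (superCocycles E N c p)).map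
        (cocyclesEquiv (E := E) (N := N) c hp).toLinearMap =
      (periodicCoboundaries E N c m).submoduleOf (periodicCocycles E N c m) := by
  -- Primitives have degree `m - 1` on one side and parity `p + 1` on the other; these match because
  -- `-1 = 1` modulo 2.
  have hp' : ((m - 1 : ℤ) : ZMod 2) = p + 1 := by
    rw [← hp]
    push_cast
    exact CharTwo.sub_eq_add _ _
  ext ζ
  rw [Submodule.mem_map_equiv, Submodule.submoduleOf, Submodule.submoduleOf, Submodule.mem_comap,
    Submodule.mem_comap, Submodule.subtype_apply, Submodule.subtype_apply,
    mem_superCoboundaries, mem_periodicCoboundaries]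
  have hζ : insertU m (setU (ζ : ℤ → FieldSeq E N)) = ζ :=
    insertU_setU (mem_periodicCocycles.1 ζ.2).1.2
  constructor
  · rintro ⟨η, hη, h⟩
    refine ⟨insertU (m - 1) η, insertU_mem_periodicForms _ hη.1, ?_⟩
    rw [periodicD_insertU, h, sub_add_cancel, coe_cocyclesEquiv_symm, hζ]
  · rintro ⟨ξ, hξ, h⟩
    refine ⟨setU ξ, setU_mem_superForms hp' hξ, ?_⟩
    rw [← setU_periodicD c hξ, h, coe_cocyclesEquiv_symm]

/-- The isomorphism induced by `r_m` in cohomology. -/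
noncomputable def cohomologyEquiv (c : ℝ) {m : ℤ} {p : ZMod 2} (hp : (m : ZMod 2) = p) :
    SuperCohomology E N c p ≃ₗ[ℂ] PeriodicCohomology E N c m :=
  Submodule.Quotient.equiv _ _ (cocyclesEquiv c hp) (map_cocyclesEquiv_coboundaries c hp)

end SettingU

end CircleCohomology

theorem mainTheorem8
    {E : Type u} [AddCommGroup E] [Module ℝ E] [TopologicalSpace E] [IsTopologicalAddGroup E]
    [ContinuousSMul ℝ E] [T2Space E] [LocallyConvexSpace ℝ E]
    {N : Type v} [TopologicalSpace N] [ChartedSpace E N]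
    (hN : CircleCohomology.IsSmoothManifold E N)
    [MulAction Circle N] (hact : CircleCohomology.IsSmoothCircleAction E N)
    (c : ℝ) (hc : c ≠ 0)
    (k m : ℤ) (p : ZMod 2) (hmp : (m = 2 * k ∧ p = 0) ∨ (m = 2 * k + 1 ∧ p = 1)) :
    -- `q_m` and `r_m` are mutually inverse on the level of complexes
    (∀ ζ ∈ CircleCohomology.periodicForms E N m,
      CircleCohomology.setU ζ ∈ CircleCohomology.superForms E N p ∧
      CircleCohomology.insertU m (CircleCohomology.setU ζ) = ζ) ∧
    (∀ ω ∈ CircleCohomology.superForms E N p,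
      CircleCohomology.insertU m ω ∈ CircleCohomology.periodicForms E N m ∧
      CircleCohomology.setU (CircleCohomology.insertU m ω) = ω) ∧
    -- they intertwine `d - u i_X` with `d + i_X`
    (∀ ζ ∈ CircleCohomology.periodicForms E N m,
      CircleCohomology.setU (CircleCohomology.periodicD c ζ) =
        CircleCohomology.superD c (CircleCohomology.setU ζ)) ∧
    (∀ ω ∈ CircleCohomology.superForms E N p,
      CircleCohomology.periodicD c (CircleCohomology.insertU m ω) =
        CircleCohomology.insertU (m + 1) (CircleCohomology.superD c ω)) ∧
    -- they induce mutually inverse isomorphisms in cohomology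
    ∃ Q : CircleCohomology.PeriodicCohomology E N c m ≃ₗ[ℂ]
        CircleCohomology.SuperCohomology E N c p,
      (∀ (ζ : ℤ → CircleCohomology.FieldSeq E N)
        (hζ : ζ ∈ CircleCohomology.periodicForms E N m)
        (hD : CircleCohomology.periodicD c ζ = 0),
        ∃ (hq : CircleCohomology.setU ζ ∈ CircleCohomology.superForms E N p)
          (hqD : CircleCohomology.superD c (CircleCohomology.setU ζ) = 0),
          Q (CircleCohomology.periodicClass ζ hζ hD) =
            CircleCohomology.superClass (CircleCohomology.setU ζ) hq hqD) ∧
      (∀ (ω : CircleCohomology.FieldSeq E N)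
        (hω : ω ∈ CircleCohomology.superForms E N p)
        (hD : CircleCohomology.superD c ω = 0),
        ∃ (hr : CircleCohomology.insertU m ω ∈ CircleCohomology.periodicForms E N m)
          (hrD : CircleCohomology.periodicD c (CircleCohomology.insertU m ω) = 0),
          Q.symm (CircleCohomology.superClass ω hω hD) =
            CircleCohomology.periodicClass (CircleCohomology.insertU m ω) hr hrD) := by
  have hp : (m : ZMod 2) = p := by
    have h2 : (2 : ZMod 2) = 0 := rfl
    rcases hmp with ⟨rfl, rfl⟩ | ⟨rfl, rfl⟩ <;> simp [h2]
  refine ⟨fun ζ hζ => ⟨CircleCohomology.setU_mem_superForms hp hζ,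
      CircleCohomology.insertU_setU hζ.2⟩,
    fun ω hω => ⟨CircleCohomology.insertU_mem_periodicForms m hω.1,
      CircleCohomology.setU_insertU hp hω.2⟩,
    fun ζ hζ => CircleCohomology.setU_periodicD c hζ,
    fun ω _ => CircleCohomology.periodicD_insertU c m ω,
    -- `cohomologyEquiv` is induced by `r_m`, so its inverse is induced by `q_m`. Both act on
    -- representatives by definition, hence the closing `rfl`s.
    (CircleCohomology.cohomologyEquiv c hp).symm, fun ζ hζ hD => ?_, fun ω hω hD => ?_⟩
  · exact ⟨CircleCohomology.setU_mem_superForms hp hζ,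
      CircleCohomology.superD_setU_eq_zero hζ hD, rfl⟩
  · exact ⟨CircleCohomology.insertU_mem_periodicForms m hω.1,
      by rw [CircleCohomology.periodicD_insertU, hD, CircleCohomology.insertU_zero], rfl⟩
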